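/- Let $\mathcal{G}$ be an étale groupoid, i.e. a second countable, locally compact, Hausdorff topological groupoid whose range and source maps $r,s$ are local homeomorphisms onto the unit space $\mathcal{G}^{(0)}$. Let $C_r^*(\mathcal{G})$ be its reduced $C^*$-algebra, the completion of $C_c(\mathcal{G})$ in the norm $\|f\|=\sup_{u\in\mathcal{G}^{(0)}}\|\mathrm{Ind}_u(f)\|$, where $\mathrm{Ind}_u(f)\in B(\ell^2(\mathcal{G}_u))$ is given by $(\mathrm{Ind}_u(f)\xi)(\gamma)=\sum_{\gamma'\in\mathcal{G}_u}f(\gamma\gamma'^{-1})\xi(\gamma')$, with $\mathcal{G}_u=s^{-1}(u)$. Elements $a\in C_r^*(\mathcal{G})$ are regarded as functions on $\mathcal{G}$ through the canonical injection $C_r^*(\mathcal{G})\to C_0(\mathcal{G})$, which is the continuous extension of the identity on $C_c(\mathcal{G})$. A *diagonal bimodule* is a norm closed subspace $M$ of $C_r^*(\mathcal{G})$ with $ab,ba\in M$ for all $a\in M$ and $b\in C_0(\mathcal{G}^{(0)})$; its spectrum is $\sigma(M)=\{\gamma\in\mathcal{G}: a(\gamma)\neq 0\text{ for some }a\in M\}$,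 and $M$ is *spectral* if $M=\{a\in C_r^*(\mathcal{G}): a(\gamma)=0\text{ for all }\gamma\notin\sigma(M)\}$. Suppose that $\mathcal{G}$ is non-principal, i.e. its isotropy bundle $\mathcal{G}'=\{\gamma: r(\gamma)=s(\gamma)\}$ is not equal to $\mathcal{G}^{(0)}$. Then $C_r^*(\mathcal{G})$ has a diagonal bimodule that is not spectral. Moreover, for every $\gamma_0\in\mathcal{G}'\setminus\mathcal{G}^{(0)}$ the set $\{a\in C_r^*(\mathcal{G}): a(\gamma_0)=a(r(\gamma_0))\}$ is a diagonal bimodule that is not spectral. -/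

import Mathlib

open scoped ENNReal Topology CompactlySupported

/-- A groupoid, presented through its set `G` of arrows: units are identified with identity arrows,
so the range map `r` and the source map `s` take values in `G`. The product `mul x y` is meaningful
only for composable pairs, that is, when `s x = r y`; no law constrains its other values. -/
class ArrowGroupoid (G : Type*) where
  r : G → G
  s : G → G
  inv : G → G
  mul : G → G → G
  s_r : ∀ x, s (r x) = r x
  r_s : ∀ x, r (s x) = s x
  r_mul : ∀ x y, s x = r y → r (mul x y) = r x
  s_mul : ∀ x y, s x = r y → s (mul x y) = s y
  mul_mul : ∀ x y z, s x = r y → s y = r z → mul (mul x y) z = mul x (mul y z)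
  r_mul_self : ∀ x, mul (r x) x = x
  mul_s_self : ∀ x, mul x (s x) = x
  r_inv : ∀ x, r (inv x) = s x
  s_inv : ∀ x, s (inv x) = r x
  mul_inv_self : ∀ x, mul x (inv x) = r x
  inv_mul_self : ∀ x, mul (inv x) x = s x

namespace ArrowGroupoid

/-- The unit space. It carries the subspace topology of `G`. -/
def units (G : Type*) [ArrowGroupoid G] : Set G := Set.range (r : G → G)

/-- The isotropy bundle: the union of the isotropy groups over all units. -/
def isotropy (G : Type*) [ArrowGroupoid G] : Set G := {x | r x = s x}

/-- A groupoid is principal if its isotropy bundle consists of units only. -/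
def IsPrincipal (G : Type*) [ArrowGroupoid G] : Prop := isotropy G = units G

/-- The range map as a map onto the unit space. -/
def rangeMap (G : Type*) [ArrowGroupoid G] : G → units G := fun x => ⟨r x, x, rfl⟩

/-- The source map as a map onto the unit space. -/
def sourceMap (G : Type*) [ArrowGroupoid G] : G → units G := fun x => ⟨s x, s x, r_s x⟩

end ArrowGroupoid

open ArrowGroupoid in
/-- Étale groupoids: second countable, locally compact, Hausdorff topological groupoids whose range
and source maps are local homeomorphisms onto the unit space. -/
class EtaleGroupoid (G : Type*) [TopologicalSpace G] [ArrowGroupoid G] : Prop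
    extends SecondCountableTopology G, LocallyCompactSpace G, T2Space G where
  continuous_inv : Continuous (inv : G → G)
  continuousOn_mul : ContinuousOn (fun p : G × G => mul p.1 p.2) {p | s p.1 = r p.2}
  isLocalHomeomorph_r : IsLocalHomeomorph (rangeMap G)
  isLocalHomeomorph_s : IsLocalHomeomorph (sourceMap G)

namespace ArrowGroupoid

/-- The source fibre `G_u` over `u`. -/
abbrev Fibre (G : Type*) [ArrowGroupoid G] (u : units G) : Type _ := {x : G // s x = (u : G)}

/-- The Hilbert space `ℓ²(G_u)`. -/
abbrev FibreL2 (G : Type*) [ArrowGroupoid G] (u : units G) : Type _ :=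
  lp (fun _ : Fibre G u => ℂ) 2

/-- The C*-algebra of all bounded families `(T_u)`, with `T_u` a bounded operator on `ℓ²(G_u)`,
under the norm `sup_u ‖T_u‖` and the pointwise operations. -/
abbrev FibreOps (G : Type*) [ArrowGroupoid G] : Type _ :=
  lp (fun u : units G => FibreL2 G u →L[ℂ] FibreL2 G u) ∞

section Instances

variable (G : Type*) [ArrowGroupoid G]

noncomputable instance (u : units G) : NormedRing (FibreL2 G u →L[ℂ] FibreL2 G u) :=
  ContinuousLinearMap.toNormedRing

noncomputable instance (u : units G) : NormedSpace ℂ (FibreL2 G u →L[ℂ] FibreL2 G u) :=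
  ContinuousLinearMap.toNormedSpace

noncomputable instance : NonUnitalNormedRing (FibreOps G) := lp.nonUnitalNormedRing

noncomputable instance : NormedAddCommGroup (FibreOps G) := lp.normedAddCommGroup

noncomputable instance : AddCommGroup (FibreOps G) := NormedAddCommGroup.toAddCommGroup

noncomputable instance : AddCommMonoid (FibreOps G) := AddCommGroup.toAddCommMonoid

noncomputable instance : NormedSpace ℂ (FibreOps G) := lp.instNormedSpace

noncomputable instance : Module ℂ (FibreOps G) := NormedSpace.toModule

noncomputable instance : SMul ℂ (FibreOps G) := (NormedSpace.toModule (𝕜 := ℂ)).toSMul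

noncomputable instance : SeminormedAddCommGroup (FibreOps G) :=
  NormedAddCommGroup.toSeminormedAddCommGroup

noncomputable instance : NonUnitalSeminormedRing (FibreOps G) :=
  NonUnitalNormedRing.toNonUnitalSeminormedRing

instance : IsBoundedSMul ℂ (FibreOps G) := NormedSpace.toIsBoundedSMul

instance : ContinuousSMul ℂ (FibreOps G) := IsBoundedSMul.continuousSMul

instance : ContinuousConstSMul ℂ (FibreOps G) := ContinuousSMul.continuousConstSMul

instance : IsTopologicalAddGroup (FibreOps G) := SeminormedAddCommGroup.toIsTopologicalAddGroup

instance : ContinuousAdd (FibreOps G) := IsTopologicalAddGroup.toContinuousAdd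

instance : ContinuousMul (FibreOps G) :=
  IsTopologicalSemiring.toContinuousMul (R := FibreOps G)

end Instances

section Kernel

variable {ι : Type*}

theorem finite_of_card_bound {p : ι → Prop} {n : ℕ}
    (h : ∀ t : Finset ι, (∀ j ∈ t, p j) → t.card ≤ n) : {j | p j}.Finite := by
  by_contra hinf
  obtain ⟨t, ht, hc⟩ := Set.Infinite.exists_subset_card_eq hinf (n + 1)
  have := h t (fun j hj => ht hj)
  omega

theorem kernel_sum_le {k : ι → ι → ℂ} {n m : ℕ} {C : ℝ} (hC : ∀ i j, ‖k i j‖ ≤ C)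
    (hrow : ∀ i, ∀ t : Finset ι, (∀ j ∈ t, k i j ≠ 0) → t.card ≤ n)
    (hcol : ∀ j, ∀ t : Finset ι, (∀ i ∈ t, k i j ≠ 0) → t.card ≤ m)
    (x : lp (fun _ : ι => ℂ) 2) (S : Finset ι) :
    ∑ i ∈ S, ‖∑' j, k i j * x j‖ ^ 2 ≤ n * m * C ^ 2 * ‖x‖ ^ 2 := by
  classical
  have hfin : ∀ i, {j | k i j ≠ 0}.Finite := fun i => finite_of_card_bound (hrow i)
  set R : ι → Finset ι := fun i => (hfin i).toFinset with hR
  have hmem : ∀ i j, j ∈ R i ↔ k i j ≠ 0 := fun i j => by simp [hR]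
  set T : Finset ι := S.biUnion R with hT
  have hx : ∑ j ∈ T, ‖x j‖ ^ 2 ≤ ‖x‖ ^ 2 := by
    have := lp.sum_rpow_le_norm_rpow (p := 2) (by norm_num) x T
    simpa using this
  have h1 : ∀ i ∈ S, ‖∑' j, k i j * x j‖ ^ 2
      ≤ n * C ^ 2 * ∑ j ∈ T, if k i j ≠ 0 then ‖x j‖ ^ 2 else 0 := by
    intro i hi
    have e : ∑' j, k i j * x j = ∑ j ∈ R i, k i j * x j := by
      refine tsum_eq_sum (fun j hj => ?_)
      have : k i j = 0 := by
        by_contra h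
        exact hj ((hmem i j).2 h)
      simp [this]
    have hRT : R i ⊆ T := Finset.subset_biUnion_of_mem R hi
    have e2 : (∑ j ∈ T, if k i j ≠ 0 then ‖x j‖ ^ 2 else 0) = ∑ j ∈ R i, ‖x j‖ ^ 2 := by
      rw [← Finset.sum_filter]
      refine Finset.sum_congr ?_ (fun _ _ => rfl)
      ext j
      simp only [Finset.mem_filter]
      exact ⟨fun h => (hmem i j).2 h.2, fun h => ⟨hRT h, (hmem i j).1 h⟩⟩
    rw [e, e2]
    have hcard : ((R i).card : ℝ) ≤ n := by
      exact_mod_cast hrow i (R i) (fun j hj => (hmem i j).1 hj)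
    calc ‖∑ j ∈ R i, k i j * x j‖ ^ 2 ≤ (∑ j ∈ R i, ‖k i j * x j‖) ^ 2 := by
          gcongr
          exact norm_sum_le _ _
      _ ≤ (R i).card * ∑ j ∈ R i, ‖k i j * x j‖ ^ 2 := sq_sum_le_card_mul_sum_sq
      _ ≤ n * ∑ j ∈ R i, C ^ 2 * ‖x j‖ ^ 2 := by
          gcongr with j hj
          rw [norm_mul, mul_pow]
          have := hC i j
          gcongr
      _ = n * C ^ 2 * ∑ j ∈ R i, ‖x j‖ ^ 2 := by rw [← Finset.mul_sum, mul_assoc]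
  calc ∑ i ∈ S, ‖∑' j, k i j * x j‖ ^ 2
      ≤ ∑ i ∈ S, n * C ^ 2 * ∑ j ∈ T, (if k i j ≠ 0 then ‖x j‖ ^ 2 else 0) :=
        Finset.sum_le_sum h1
    _ = n * C ^ 2 * ∑ j ∈ T, ∑ i ∈ S, (if k i j ≠ 0 then ‖x j‖ ^ 2 else 0) := by
        rw [← Finset.mul_sum, Finset.sum_comm]
    _ ≤ n * C ^ 2 * ∑ j ∈ T, m * ‖x j‖ ^ 2 := by
        gcongr with j hj
        rw [← Finset.sum_filter, Finset.sum_const, nsmul_eq_mul]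
        gcongr
        exact hcol j _ (fun i hi => (Finset.mem_filter.1 hi).2)
    _ = n * m * C ^ 2 * ∑ j ∈ T, ‖x j‖ ^ 2 := by rw [← Finset.mul_sum]; ring
    _ ≤ n * m * C ^ 2 * ‖x‖ ^ 2 := by gcongr

/-- A bounded matrix `k` whose rows and columns have uniformly finitely many nonzero entries. -/
def IsBandKernel (k : ι → ι → ℂ) (n m : ℕ) (C : ℝ) : Prop :=
  0 ≤ C ∧ (∀ i j, ‖k i j‖ ≤ C) ∧
  (∀ i, ∀ t : Finset ι, (∀ j ∈ t, k i j ≠ 0) → t.card ≤ n) ∧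
  (∀ j, ∀ t : Finset ι, (∀ i ∈ t, k i j ≠ 0) → t.card ≤ m)

theorem IsBandKernel.memlp {k : ι → ι → ℂ} {n m : ℕ} {C : ℝ} (h : IsBandKernel k n m C)
    (x : lp (fun _ : ι => ℂ) 2) : Memℓp (fun i => ∑' j, k i j * x j) 2 := by
  refine memℓp_gen' (C := n * m * C ^ 2 * ‖x‖ ^ 2) (fun S => ?_)
  simpa using kernel_sum_le h.2.1 h.2.2.1 h.2.2.2 x S

theorem IsBandKernel.summable {k : ι → ι → ℂ} {n m : ℕ} {C : ℝ} (h : IsBandKernel k n m C)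
    (x : ι → ℂ) (i : ι) : Summable (fun j => k i j * x j) := by
  refine summable_of_hasFiniteSupport ((finite_of_card_bound (h.2.2.1 i)).subset ?_)
  intro j hj hk
  exact hj (by simp [hk])

/-- The bounded operator on `ℓ²` with matrix `k`. -/
noncomputable def kernelOp (k : ι → ι → ℂ) (n m : ℕ) (C : ℝ) (h : IsBandKernel k n m C) :
    lp (fun _ : ι => ℂ) 2 →L[ℂ] lp (fun _ : ι => ℂ) 2 :=
  LinearMap.mkContinuous
    { toFun := fun x => ⟨fun i => ∑' j, k i j * x j, h.memlp x⟩
      map_add' := fun x y => by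
        ext i
        change ∑' j, k i j * (x j + y j) = (∑' j, k i j * x j) + ∑' j, k i j * y j
        rw [← (h.summable x i).tsum_add (h.summable y i)]
        exact tsum_congr (fun j => mul_add _ _ _)
      map_smul' := fun c x => by
        ext i
        change ∑' j, k i j * (c * x j) = c * ∑' j, k i j * x j
        rw [← tsum_mul_left]
        exact tsum_congr (fun j => mul_left_comm _ _ _) }
    (Real.sqrt (n * m * C ^ 2))
    (fun x => by
      refine lp.norm_le_of_forall_sum_le (by norm_num) (by positivity) (fun S => ?_)
      have h1 := kernel_sum_le h.2.1 h.2.2.1 h.2.2.2 x S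
      have h2 : (Real.sqrt (n * m * C ^ 2) * ‖x‖) ^ 2 = n * m * C ^ 2 * ‖x‖ ^ 2 := by
        rw [mul_pow, Real.sq_sqrt (by positivity)]
      simpa [h2] using h1)

theorem kernelOp_apply (k : ι → ι → ℂ) (n m : ℕ) (C : ℝ) (h : IsBandKernel k n m C)
    (x : lp (fun _ : ι => ℂ) 2) (i : ι) : kernelOp k n m C h x i = ∑' j, k i j * x j := rfl

theorem norm_kernelOp_le (k : ι → ι → ℂ) (n m : ℕ) (C : ℝ) (h : IsBandKernel k n m C) :
    ‖kernelOp k n m C h‖ ≤ Real.sqrt (n * m * C ^ 2) :=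
  LinearMap.mkContinuous_norm_le _ (Real.sqrt_nonneg _) _

end Kernel

section Regular

theorem exists_card_bound {G Y : Type*} [TopologicalSpace G] {p : G → Y} (hp : ∀ x, ∃ U ∈ 𝓝 x, Set.InjOn p U)
    {K : Set G} (hK : IsCompact K) :
    ∃ n : ℕ, ∀ y, ∀ t : Finset G, (∀ x ∈ t, x ∈ K ∧ p x = y) → t.card ≤ n := by
  classical
  refine hK.induction_on (p := fun K => ∃ n : ℕ, ∀ y, ∀ t : Finset G,
    (∀ x ∈ t, x ∈ K ∧ p x = y) → t.card ≤ n) ?_ ?_ ?_ ?_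
  · refine ⟨0, fun y t ht => ?_⟩
    rw [Nat.le_zero, Finset.card_eq_zero, Finset.eq_empty_iff_forall_notMem]
    exact fun x hx => (ht x hx).1
  · rintro A B hAB ⟨n, hn⟩
    exact ⟨n, fun y t ht => hn y t (fun x hx => ⟨hAB (ht x hx).1, (ht x hx).2⟩)⟩
  · rintro A B ⟨n, hn⟩ ⟨m, hm⟩
    refine ⟨n + m, fun y t ht => ?_⟩
    have h1 := hn y (t.filter (· ∈ A)) (fun x hx => by
      rw [Finset.mem_filter] at hx
      exact ⟨hx.2, (ht x hx.1).2⟩)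
    have h2 := hm y (t.filter (¬ · ∈ A)) (fun x hx => by
      rw [Finset.mem_filter] at hx
      exact ⟨(ht x hx.1).1.resolve_left hx.2, (ht x hx.1).2⟩)
    have h3 := Finset.card_filter_add_card_filter_not (s := t) (· ∈ A)
    omega
  · intro x _
    obtain ⟨U, hU, hinj⟩ := hp x
    refine ⟨U, mem_nhdsWithin_of_mem_nhds hU, 1, fun y t ht => ?_⟩
    rw [Finset.card_le_one]
    exact fun a ha b hb => hinj (ht a ha).1 (ht b hb).1 ((ht a ha).2.trans (ht b hb).2.symm)

variable {G : Type*} [ArrowGroupoid G]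

theorem inv_mul_mul {x y : G} (h : s x = r y) : mul (inv x) (mul x y) = y := by
  rw [← mul_mul _ _ _ (s_inv x) h, inv_mul_self, h, r_mul_self]

theorem mul_inv_mul {x y : G} (h : s x = s y) : mul (mul x (inv y)) y = x := by
  rw [mul_mul _ _ _ (h.trans (r_inv y).symm) (s_inv y), inv_mul_self, ← h, mul_s_self]

protected theorem inv_inv (x : G) : inv (inv x) = x := by
  have h := inv_mul_mul (x := inv x) (y := x) (s_inv x)
  rw [inv_mul_self, ← r_inv x, ← s_inv (inv x), mul_s_self] at h
  exact h

variable [TopologicalSpace G]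

/-- The matrix `(γ, γ') ↦ f (γ γ'⁻¹)`. -/
noncomputable def regKernel (f : C_c(G, ℂ)) (u : units G) : Fibre G u → Fibre G u → ℂ :=
  fun x y => f (mul x.1 (inv y.1))

variable [EtaleGroupoid G]

theorem exists_isBandKernel (f : C_c(G, ℂ)) :
    ∃ (n m : ℕ) (C : ℝ), ∀ u : units G, IsBandKernel (regKernel f u) n m C := by
  classical
  have hloc : ∀ {q : G → units G}, IsLocalHomeomorph q →
      ∀ x, ∃ U ∈ 𝓝 x, Set.InjOn q U := by
    intro q hq x
    obtain ⟨e, hx, rfl⟩ := hq x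
    exact ⟨e.source, e.open_source.mem_nhds hx, e.injOn⟩
  have hK : IsCompact (tsupport f) := f.hasCompactSupport
  obtain ⟨n, hn⟩ := exists_card_bound (hloc (EtaleGroupoid.isLocalHomeomorph_r (G := G))) hK
  obtain ⟨m, hm⟩ := exists_card_bound (hloc (EtaleGroupoid.isLocalHomeomorph_s (G := G))) hK
  obtain ⟨C, hC⟩ := f.hasCompactSupport.exists_bound_of_continuous f.continuous
  refine ⟨n, m, |C|, fun u => ⟨abs_nonneg C, fun x y => (hC _).trans (le_abs_self C), ?_, ?_⟩⟩
  · intro x t ht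
    have hinj : Set.InjOn (fun y : Fibre G u => mul x.1 (inv y.1)) (t : Set (Fibre G u)) := by
      intro y _ z _ hyz
      have hy : s x.1 = r (inv y.1) := by rw [r_inv, x.2, y.2]
      have hz : s x.1 = r (inv z.1) := by rw [r_inv, x.2, z.2]
      have h1 : inv y.1 = inv z.1 := by
        rw [← inv_mul_mul hy, ← inv_mul_mul hz]
        exact congrArg _ hyz
      exact Subtype.ext (by rw [← ArrowGroupoid.inv_inv y.1, h1, ArrowGroupoid.inv_inv])
    rw [← Finset.card_image_of_injOn hinj]
    refine hn (rangeMap G x.1) _ (fun w hw => ?_)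
    obtain ⟨y, hy, rfl⟩ := Finset.mem_image.1 hw
    refine ⟨subset_tsupport _ (ht y hy), Subtype.ext ?_⟩
    exact r_mul _ _ (by rw [r_inv, x.2, y.2])
  · intro y t ht
    have hinj : Set.InjOn (fun x : Fibre G u => mul x.1 (inv y.1)) (t : Set (Fibre G u)) := by
      intro x _ z _ hxz
      refine Subtype.ext ?_
      rw [← mul_inv_mul (x.2.trans y.2.symm), ← mul_inv_mul (z.2.trans y.2.symm)]
      exact congrArg (fun w => mul w y.1) hxz
    rw [← Finset.card_image_of_injOn hinj]
    refine hm (rangeMap G y.1) _ (fun w hw => ?_)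
    obtain ⟨x, hx, rfl⟩ := Finset.mem_image.1 hw
    refine ⟨subset_tsupport _ (ht x hx), Subtype.ext ?_⟩
    change s (mul x.1 (inv y.1)) = r y.1
    rw [s_mul _ _ (by rw [r_inv, x.2, y.2]), s_inv]

/-- The regular representation `Ind_u` on `ℓ²(G_u)`; its defining formula is `ind_apply`. -/
noncomputable def ind (u : units G) (f : C_c(G, ℂ)) : FibreL2 G u →L[ℂ] FibreL2 G u :=
  kernelOp (regKernel f u) _ _ _ ((exists_isBandKernel f).choose_spec.choose_spec.choose_spec u)

theorem ind_apply (u : units G) (f : C_c(G, ℂ)) (ξ : FibreL2 G u) (x : Fibre G u) :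
    ind u f ξ x = ∑' y : Fibre G u, f (mul x.1 (inv y.1)) * ξ y := rfl

theorem memlp_ind (f : C_c(G, ℂ)) : Memℓp (fun u : units G => ind u f) ∞ := by
  refine memℓp_infty (bddAbove_def.2 ⟨Real.sqrt ((exists_isBandKernel f).choose *
    (exists_isBandKernel f).choose_spec.choose *
    (exists_isBandKernel f).choose_spec.choose_spec.choose ^ 2), ?_⟩)
  rintro _ ⟨u, rfl⟩
  exact norm_kernelOp_le _ _ _ _
    ((exists_isBandKernel f).choose_spec.choose_spec.choose_spec u)

theorem summable_ind (u : units G) (f : C_c(G, ℂ)) (ξ : FibreL2 G u) (x : Fibre G u) :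
    Summable (fun y : Fibre G u => f (mul x.1 (inv y.1)) * ξ y) :=
  ((exists_isBandKernel f).choose_spec.choose_spec.choose_spec u).summable _ x

/-- The linear map `f ↦ (Ind_u f)_u`. The norm of the value at `f` is `sup_u ‖Ind_u f‖`, the reduced
norm of `f`. -/
noncomputable def reg (G : Type*) [TopologicalSpace G] [ArrowGroupoid G] [EtaleGroupoid G] :
    C_c(G, ℂ) →ₗ[ℂ] FibreOps G where
  toFun f := ⟨fun u => ind u f, memlp_ind f⟩
  map_add' f g := by
    ext u ξ x
    change ind u (f + g) ξ x = ind u f ξ x + ind u g ξ x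
    rw [ind_apply, ind_apply, ind_apply,
      ← (summable_ind u f ξ x).tsum_add (summable_ind u g ξ x)]
    exact tsum_congr (fun y => add_mul _ _ _)
  map_smul' c f := by
    ext u ξ x
    change ind u (c • f) ξ x = c * ind u f ξ x
    rw [ind_apply, ind_apply, ← tsum_mul_left]
    exact tsum_congr (fun y => mul_assoc _ _ _)

theorem reg_apply (f : C_c(G, ℂ)) (u : units G) : (reg G f : ∀ _, _) u = ind u f := rfl

theorem norm_reg (f : C_c(G, ℂ)) : ‖reg G f‖ = ⨆ u : units G, ‖ind u f‖ :=
  lp.norm_eq_ciSup _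

end Regular

section Reduced

variable (G : Type*) [TopologicalSpace G] [ArrowGroupoid G] [EtaleGroupoid G]

/-- The reduced C*-algebra `C_r^*(G)`: the completion of `C_c(G)` in the reduced norm, realized as
the closure of the copy `reg G` of `C_c(G)` in the complete space `FibreOps G`, whose norm restricts
to the reduced norm. Products are computed in `FibreOps G`. -/
noncomputable def reducedCStar : Submodule ℂ (FibreOps G) :=
  (LinearMap.range (reg G)).topologicalClosure

/-- The subspace `C_c(G⁰)` of `C_c(G)`: the functions that vanish off the (clopen) unit space. -/
def ccUnits : Submodule ℂ C_c(G, ℂ) where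
  carrier := {f | ∀ x, x ∉ units G → f x = 0}
  zero_mem' := fun _ _ => rfl
  add_mem' := fun hf hg x hx => by
    rw [CompactlySupportedContinuousMap.add_apply, hf x hx, hg x hx, add_zero]
  smul_mem' := fun c f hf x hx => by
    change c * f x = 0
    rw [hf x hx, mul_zero]

/-- The diagonal subalgebra `C_0(G⁰)` of `C_r^*(G)`: the closure of `C_c(G⁰)`. -/
noncomputable def diagonal : Submodule ℂ (FibreOps G) :=
  ((ccUnits G).map (reg G)).topologicalClosure

end Reduced

section Coeff

variable {G : Type*} [ArrowGroupoid G]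

theorem s_of_mem_units (u : units G) : s (u : G) = (u : G) := by
  obtain ⟨x, hx⟩ := u.2
  rw [← hx, s_r]

open Classical in
/-- The value `a(γ) = ⟨a_u δ_u, δ_γ⟩`, where `u = s(γ)`, of an element `a` of the reduced C*-algebra,
regarded as a function on `G`. It depends linearly and continuously on `a` and extends the evaluation
of functions in `C_c(G)`, see `coeff_reg`. -/
noncomputable def coeff (a : FibreOps G) (γ : G) : ℂ :=
  (a : ∀ _, _) (sourceMap G γ)
    (lp.single 2 (⟨s γ, s_of_mem_units (sourceMap G γ)⟩ : Fibre G (sourceMap G γ)) (1 : ℂ))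
    ⟨γ, rfl⟩

theorem coeff_reg [TopologicalSpace G] [EtaleGroupoid G] (f : C_c(G, ℂ)) (γ : G) :
    coeff (reg G f) γ = f γ := by
  classical
  have hs : inv (s γ) = s γ := by
    have h1 : s (s γ) = s γ := s_of_mem_units (sourceMap G γ)
    have h2 : r (inv (s γ)) = s γ := by rw [r_inv, h1]
    have h := r_mul_self (inv (s γ))
    rw [h2, mul_inv_self, r_s] at h
    exact h.symm
  rw [coeff, reg_apply, ind_apply, tsum_eq_single ⟨s γ, s_of_mem_units (sourceMap G γ)⟩]
  · simp [hs, mul_s_self]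
  · intro y hy
    simp [lp.single_apply, hy]

end Coeff

section Bimodules

variable {G : Type*} [TopologicalSpace G] [ArrowGroupoid G] [EtaleGroupoid G]

/-- Diagonal bimodules: norm closed subspaces `M` of `C_r^*(G)` with `ab, ba ∈ M` for all `a ∈ M` and
`b ∈ C_0(G⁰)`. -/
def IsDiagonalBimodule (M : Submodule ℂ (FibreOps G)) : Prop :=
  M ≤ reducedCStar G ∧ IsClosed (M : Set (FibreOps G)) ∧
    ∀ a ∈ M, ∀ b ∈ diagonal G, a * b ∈ M ∧ b * a ∈ M

/-- The spectrum `σ(M)`. -/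
def spectrumOf (M : Submodule ℂ (FibreOps G)) : Set G := {γ | ∃ a ∈ M, coeff a γ ≠ 0}

/-- The set `A(P)` of all elements of `C_r^*(G)` that vanish off `P`. -/
def vanishingOff (P : Set G) : Set (FibreOps G) :=
  {a | a ∈ reducedCStar G ∧ ∀ γ, γ ∉ P → coeff a γ = 0}

/-- `M` is spectral if `M = A(σ(M))`. -/
def IsSpectral (M : Submodule ℂ (FibreOps G)) : Prop :=
  (M : Set (FibreOps G)) = vanishingOff (spectrumOf M)

end Bimodules

end ArrowGroupoid

/-! Multiplying `a` by a diagonal element `b` only rescales its values: `a * b` has value `a(γ) b(s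
γ)` at `γ`, and `b * a` has value `b(r γ) a(γ)` (`coeff_mul_diagonal`, `coeff_diagonal_mul`). Two
arrows with the same range and source are thus rescaled alike, so the closed condition of equal
values at both defines a diagonal bimodule. A non-unit isotropy arrow `γ₀` and the unit `r γ₀` form
such a pair of distinct arrows.

Urysohn functions show that this bimodule is not spectral. One equal to 1 at `x` and at both arrows
puts any `x` in the spectrum, so the elements vanishing off the spectrum are all of the reduced
algebra. One separating the two arrows lies in the algebra but not in the bimodule. -/

namespace ArrowGroupoid

/-! ### Groupoid identities. -/

section Algebra

variable {G : Type*} [ArrowGroupoid G]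

theorem r_r (x : G) : r (r x) = r x := by
  rw [← s_r x, r_s]

/-- A unit equals its own source, here `r y`; hence `x = (x y⁻¹) y = r(y) y = y`. This makes the
matrix of a function supported on units diagonal. -/
theorem eq_of_mul_inv_mem_units {x y : G} (h : s x = s y) (hu : mul x (inv y) ∈ units G) :
    x = y := by
  obtain ⟨z, hz⟩ := hu
  have hc : s x = r (inv y) := by rw [r_inv, h]
  have h1 : mul x (inv y) = r y := by
    have := s_mul x (inv y) hc
    rw [s_inv, ← hz, s_r] at this
    rw [← hz, this]
  have h2 := mul_inv_mul h
  rw [h1, r_mul_self] at h2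
  exact h2.symm

theorem units_subset_isotropy : units G ⊆ isotropy G := by
  rintro _ ⟨x, rfl⟩
  exact (r_r x).trans (s_r x).symm

end Algebra

/-! ### Values of elements as continuous functionals, and how the diagonal rescales them. -/

section Coefficients

variable {G : Type*} [ArrowGroupoid G]

theorem mul_fibre_apply (a b : FibreOps G) (u : units G) (ξ : FibreL2 G u) :
    ((a * b : FibreOps G) : ∀ _, _) u ξ = (a : ∀ _, _) u ((b : ∀ _, _) u ξ) := rfl

/-- The matrix coefficient of the operator at `u`, as a linear functional on the operator families. -/
noncomputable def matrixCoeff (u : units G) (ξ : FibreL2 G u) (x : Fibre G u) :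
    FibreOps G →ₗ[ℂ] ℂ where
  toFun a := (a : ∀ _, _) u ξ x
  map_add' _ _ := rfl
  map_smul' _ _ := rfl

/-- Continuity carries identities checked on compactly supported functions over to norm closures. -/
theorem continuous_matrixCoeff (u : units G) (ξ : FibreL2 G u) (x : Fibre G u) :
    Continuous (matrixCoeff u ξ x) := by
  refine AddMonoidHomClass.continuous_of_bound (matrixCoeff u ξ x) ‖ξ‖ (fun a => ?_)
  calc ‖(a : ∀ _, _) u ξ x‖ ≤ ‖(a : ∀ _, _) u ξ‖ := lp.norm_apply_le_norm (by norm_num) _ x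
    _ ≤ ‖(a : ∀ _, _) u‖ * ‖ξ‖ := ContinuousLinearMap.le_opNorm _ _
    _ ≤ ‖a‖ * ‖ξ‖ := by
        gcongr
        exact lp.norm_apply_le_norm ENNReal.top_ne_zero a u
    _ = ‖ξ‖ * ‖a‖ := mul_comm _ _

open Classical in
/-- Evaluation at an arrow as a linear functional. -/
noncomputable def coeffLinear (γ : G) : FibreOps G →ₗ[ℂ] ℂ :=
  matrixCoeff (sourceMap G γ)
    (lp.single 2 (⟨s γ, s_of_mem_units (sourceMap G γ)⟩ : Fibre G (sourceMap G γ)) (1 : ℂ))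
    ⟨γ, rfl⟩

theorem coeffLinear_apply (γ : G) (a : FibreOps G) : coeffLinear γ a = coeff a γ := rfl

theorem continuous_coeff (γ : G) : Continuous (fun a : FibreOps G => coeff a γ) :=
  continuous_matrixCoeff _ _ _

variable [TopologicalSpace G] [EtaleGroupoid G]

theorem continuous_r : Continuous (r : G → G) :=
  continuous_subtype_val.comp (EtaleGroupoid.isLocalHomeomorph_r (G := G)).continuous

theorem continuous_s : Continuous (s : G → G) :=
  continuous_subtype_val.comp (EtaleGroupoid.isLocalHomeomorph_s (G := G)).continuous

theorem reg_mem_reducedCStar (f : C_c(G, ℂ)) : reg G f ∈ reducedCStar G :=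
  Submodule.le_topologicalClosure _ ⟨f, rfl⟩

/-- Only the term `y = x` survives, since `x y⁻¹` is a unit only then; there it equals `r x`. -/
theorem ind_apply_of_mem_ccUnits {g : C_c(G, ℂ)} (hg : g ∈ ccUnits G) (u : units G)
    (ξ : FibreL2 G u) (x : Fibre G u) : ind u g ξ x = g (r x.1) * ξ x := by
  rw [ind_apply, tsum_eq_single x, mul_inv_self]
  intro y hy
  rw [hg _ (fun h => hy (Subtype.ext
    (eq_of_mul_inv_mem_units (x.2.trans y.2.symm) h).symm)), zero_mul]

/-- Elements of the diagonal act on each fibre as multiplication operators. -/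
theorem diagonal_apply {b : FibreOps G} (hb : b ∈ diagonal G) (u : units G) (ξ : FibreL2 G u)
    (x : Fibre G u) : (b : ∀ _, _) u ξ x = coeff b (r x.1) * ξ x := by
  -- Both sides are continuous in `b`, so it suffices to treat the dense image of `ccUnits G`.
  have hclosed : IsClosed {b : FibreOps G | matrixCoeff u ξ x b = coeff b (r x.1) * ξ x} :=
    isClosed_eq (continuous_matrixCoeff u ξ x) ((continuous_coeff _).mul continuous_const)
  refine closure_minimal ?_ hclosed hb
  rintro _ ⟨g, hg, rfl⟩
  exact (ind_apply_of_mem_ccUnits hg u ξ x).trans (by rw [coeff_reg])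

theorem coeff_mul_diagonal (a : FibreOps G) {b : FibreOps G} (hb : b ∈ diagonal G) (γ : G) :
    coeff (a * b) γ = coeff a γ * coeff b (s γ) := by
  classical
  -- The basis vector at the unit `s γ` is an eigenvector of `b`, because `r (s γ) = s γ`.
  have key : (b : ∀ _, _) (sourceMap G γ)
      (lp.single 2 (⟨s γ, s_of_mem_units (sourceMap G γ)⟩ : Fibre G (sourceMap G γ)) (1 : ℂ))
      = coeff b (s γ) •
      lp.single 2 (⟨s γ, s_of_mem_units (sourceMap G γ)⟩ : Fibre G (sourceMap G γ)) (1 : ℂ) := by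
    ext x
    rw [diagonal_apply hb, lp.coeFn_smul, Pi.smul_apply, smul_eq_mul]
    by_cases hx : x = ⟨s γ, s_of_mem_units (sourceMap G γ)⟩
    · rw [hx, r_s]
    · simp [lp.single_apply, hx]
  rw [coeff, mul_fibre_apply]
  have h2 := congrArg (fun ξ => ((a : ∀ _, _) (sourceMap G γ) ξ : FibreL2 G _) ⟨γ, rfl⟩) key
  refine Eq.trans (by convert h2) ?_
  simp only [map_smul, lp.coeFn_smul, Pi.smul_apply, smul_eq_mul, coeff]
  rw [mul_comm]

theorem coeff_diagonal_mul (a : FibreOps G) {b : FibreOps G} (hb : b ∈ diagonal G) (γ : G) :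
    coeff (b * a) γ = coeff b (r γ) * coeff a γ := by
  rw [coeff, mul_fibre_apply, diagonal_apply hb]
  rfl

end Coefficients

/-! ### Pointwise products. -/

section PointwiseProduct

variable {G : Type*} [TopologicalSpace G]

/-- The product of a compactly supported function with a continuous function. -/
noncomputable def mulContinuous (f : C_c(G, ℂ)) (h : C(G, ℂ)) : C_c(G, ℂ) where
  toFun x := f x * h x
  continuous_toFun := f.continuous.mul h.continuous
  hasCompactSupport' := f.hasCompactSupport.mul_right

theorem mulContinuous_apply (f : C_c(G, ℂ)) (h : C(G, ℂ)) (x : G) :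
    mulContinuous f h x = f x * h x := rfl

end PointwiseProduct

/-! ### The reduced algebra is stable under multiplication by the diagonal. -/

section Products

variable {G : Type*} [TopologicalSpace G] [ArrowGroupoid G] [EtaleGroupoid G]

/-- The factor `g (r y)` produced by the diagonal operator is `g ∘ s` at `x y⁻¹`, so the product is
again the image of a compactly supported function. -/
theorem reg_mul_of_mem_ccUnits (f : C_c(G, ℂ)) {g : C_c(G, ℂ)} (hg : g ∈ ccUnits G) :
    reg G f * reg G g
      = reg G (mulContinuous f ⟨fun x => g (s x), g.continuous.comp continuous_s⟩) := by
  ext u ξ x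
  change ind u f (ind u g ξ) x = ind u _ ξ x
  rw [ind_apply, ind_apply]
  refine tsum_congr (fun y => ?_)
  rw [ind_apply_of_mem_ccUnits hg, mulContinuous_apply, ContinuousMap.coe_mk,
    s_mul _ _ (by rw [r_inv, x.2, y.2]), s_inv, mul_assoc]

/-- Here the factor is `g (r x)`, and `r (x y⁻¹) = r x` for every `y` in the sum. -/
theorem reg_mul_of_mem_ccUnits_left (f : C_c(G, ℂ)) {g : C_c(G, ℂ)} (hg : g ∈ ccUnits G) :
    reg G g * reg G f
      = reg G (mulContinuous f ⟨fun x => g (r x), g.continuous.comp continuous_r⟩) := by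
  ext u ξ x
  change ind u g (ind u f ξ) x = ind u _ ξ x
  rw [ind_apply_of_mem_ccUnits hg, ind_apply, ind_apply, ← tsum_mul_left]
  refine tsum_congr (fun y => ?_)
  rw [mulContinuous_apply, ContinuousMap.coe_mk, r_mul _ _ (by rw [r_inv, x.2, y.2])]
  ring

/-- Joint continuity of multiplication reduces this to the dense subspaces. -/
theorem mul_diagonal_mem_reducedCStar {a b : FibreOps G} (ha : a ∈ reducedCStar G)
    (hb : b ∈ diagonal G) : a * b ∈ reducedCStar G ∧ b * a ∈ reducedCStar G := by
  constructor
  · refine map_mem_closure₂ (f := fun a b : FibreOps G => a * b) continuous_mul ha hb ?_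
    rintro _ ⟨f, rfl⟩ _ ⟨g, hg, rfl⟩
    exact ⟨_, (reg_mul_of_mem_ccUnits f hg).symm⟩
  · refine map_mem_closure₂ (f := fun b a : FibreOps G => b * a) continuous_mul hb ha ?_
    rintro _ ⟨g, hg, rfl⟩ _ ⟨f, rfl⟩
    exact ⟨_, (reg_mul_of_mem_ccUnits_left f hg).symm⟩

end Products

/-! ### The bimodule of elements with equal values at two arrows. -/

section EqualValues

variable {G : Type*} [TopologicalSpace G] [ArrowGroupoid G] [EtaleGroupoid G]

theorem exists_cc_one_zero {K L : Set G} (hK : IsCompact K) (hL : IsClosed L)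
    (hKL : Disjoint K L) :
    ∃ f : C_c(G, ℂ), (∀ x ∈ K, f x = 1) ∧ ∀ x ∈ L, f x = 0 := by
  obtain ⟨f, h1, h0, hc, -⟩ := exists_continuous_one_zero_of_isCompact hK hL hKL
  refine ⟨⟨⟨fun x => (f x : ℂ), Complex.continuous_ofReal.comp f.continuous⟩,
    hc.comp_left (g := fun t : ℝ => (t : ℂ)) Complex.ofReal_zero⟩, fun x hx => ?_, fun x hx => ?_⟩
  · change ((f x : ℝ) : ℂ) = 1
    rw [h1 hx, Pi.one_apply, Complex.ofReal_one]
  · change ((f x : ℝ) : ℂ) = 0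
    rw [h0 hx, Pi.zero_apply, Complex.ofReal_zero]

/-- The elements of the reduced C*-algebra that take equal values at two given arrows. -/
noncomputable def equalValues (γ δ : G) : Submodule ℂ (FibreOps G) :=
  reducedCStar G ⊓ LinearMap.eqLocus (coeffLinear γ) (coeffLinear δ)

theorem mem_equalValues {γ δ : G} {a : FibreOps G} :
    a ∈ equalValues γ δ ↔ a ∈ reducedCStar G ∧ coeff a γ = coeff a δ := Iff.rfl

/-- Right multiplication scales both values by `b` at the common source, left multiplication by `b`
at the common range. -/
theorem isDiagonalBimodule_equalValues {γ δ : G} (hr : r γ = r δ) (hs : s γ = s δ) :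
    IsDiagonalBimodule (equalValues γ δ) := by
  refine ⟨inf_le_left, ?_, fun a ha b hb => ?_⟩
  · exact (Submodule.isClosed_topologicalClosure _).inter
      (isClosed_eq (continuous_coeff γ) (continuous_coeff δ))
  · obtain ⟨h1, h2⟩ := mul_diagonal_mem_reducedCStar ha.1 hb
    refine ⟨mem_equalValues.2 ⟨h1, ?_⟩, mem_equalValues.2 ⟨h2, ?_⟩⟩
    · rw [coeff_mul_diagonal a hb, coeff_mul_diagonal a hb, hs, (mem_equalValues.1 ha).2]
    · rw [coeff_diagonal_mul a hb, coeff_diagonal_mul a hb, hr, (mem_equalValues.1 ha).2]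

theorem spectrumOf_equalValues (γ δ : G) : spectrumOf (equalValues γ δ) = Set.univ := by
  refine Set.eq_univ_of_forall (fun x => ?_)
  -- Value 1 at all three points gives membership and nonvanishing at `x` at once, even if `x` is
  -- `γ` or `δ`.
  obtain ⟨f, hf, -⟩ := exists_cc_one_zero (K := {x, γ, δ}) (L := ∅)
    (Set.toFinite _).isCompact isClosed_empty (Set.disjoint_empty _)
  refine ⟨reg G f, mem_equalValues.2 ⟨reg_mem_reducedCStar f, ?_⟩, ?_⟩
  · rw [coeff_reg, coeff_reg, hf γ (by simp), hf δ (by simp)]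
  · rw [coeff_reg, hf x (by simp)]
    exact one_ne_zero

theorem not_isSpectral_equalValues {γ δ : G} (h : γ ≠ δ) : ¬ IsSpectral (equalValues γ δ) := by
  intro hM
  -- The spectrum imposes no vanishing condition, so any element with different values at `γ` and
  -- `δ` is a counterexample.
  obtain ⟨f, h1, h0⟩ := exists_cc_one_zero (K := {γ}) (L := {δ}) isCompact_singleton
    isClosed_singleton (by simpa using h)
  have hf : reg G f ∈ vanishingOff (spectrumOf (equalValues γ δ)) := by
    refine ⟨reg_mem_reducedCStar f, fun x hx => ?_⟩
    rw [spectrumOf_equalValues] at hx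
    exact absurd (Set.mem_univ x) hx
  rw [← hM] at hf
  have := (mem_equalValues.1 hf).2
  rw [coeff_reg, coeff_reg, h1 γ rfl, h0 δ rfl] at this
  exact one_ne_zero this

end EqualValues

end ArrowGroupoid

theorem proposition3p9 {G : Type*} [TopologicalSpace G] [ArrowGroupoid G] [EtaleGroupoid G]
    (hG : ¬ ArrowGroupoid.IsPrincipal G) :
    (∃ M : Submodule ℂ (ArrowGroupoid.FibreOps G),
      ArrowGroupoid.IsDiagonalBimodule M ∧ ¬ ArrowGroupoid.IsSpectral M) ∧
    ∀ γ₀ : G, γ₀ ∈ ArrowGroupoid.isotropy G → γ₀ ∉ ArrowGroupoid.units G →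
      ∃ M : Submodule ℂ (ArrowGroupoid.FibreOps G),
        (∀ a, a ∈ M ↔ a ∈ ArrowGroupoid.reducedCStar G ∧
          ArrowGroupoid.coeff a γ₀ = ArrowGroupoid.coeff a (ArrowGroupoid.r γ₀)) ∧
        ArrowGroupoid.IsDiagonalBimodule M ∧ ¬ ArrowGroupoid.IsSpectral M := by
  open ArrowGroupoid in
  have main : ∀ γ₀ : G, γ₀ ∈ isotropy G → γ₀ ∉ units G →
      IsDiagonalBimodule (equalValues γ₀ (r γ₀)) ∧ ¬ IsSpectral (equalValues γ₀ (r γ₀)) := by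
    intro γ hγ hu
    refine ⟨isDiagonalBimodule_equalValues (r_r γ).symm ?_, not_isSpectral_equalValues ?_⟩
    -- Isotropy enters here: the source of `r γ` is `r γ` itself, which must equal `s γ`.
    · rw [s_r]
      exact hγ.symm
    · exact fun h => hu ⟨γ, h.symm⟩
  refine ⟨?_, fun γ hγ hu => ⟨_, fun a => ArrowGroupoid.mem_equalValues, main γ hγ hu⟩⟩
  -- Units always lie in the isotropy bundle, so non-principality yields an isotropy arrow that is
  -- not a unit.
  obtain ⟨γ, hγ, hu⟩ := Set.not_subset.1
    (fun h => hG (Set.Subset.antisymm h ArrowGroupoid.units_subset_isotropy))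
  exact ⟨_, main γ hγ hu⟩
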